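/- Let $0<q<1$ and write $(a;q)_n=\prod_{k=0}^{n-1}(1-aq^k)$, $(a;q)_\infty=\prod_{k=0}^{\infty}(1-aq^k)$, $(a_1,\dots,a_m;q)_n=(a_1;q)_n\cdots(a_m;q)_n$ for $n\in\mathbb{Z}_{\ge 0}\cup\{\infty\}$, and $$ {}_r\phi_s\left({a_1,\dots,a_r\atop b_1,\dots,b_s};q,z\right)=\sum_{k=0}^\infty\frac{(a_1,\dots,a_r;q)_k}{(q,b_1,\dots,b_s;q)_k}\left((-1)^kq^{k(k-1)/2}\right)^{1+s-r}z^k. $$ Let $a,b,x,y\in\mathbb{C}$ with $x,y\neq 0$, and suppose that neither $a$ nor $b$ is of the form $q^{-k}$ with $k\in\mathbb{Z}_{\ge 0}$. If $\max\{|x|,|abxy|\}<1$, then $$ \sum_{n=0}^\infty\frac{(a,b;q)_n\,x^n}{(q,abxy;q)_n}\;{}_3\phi_2\left({q^{-n},1/x,1/y\atop a,b};q,abxyq^n\right)=\frac{(ax,bx;q)_\infty}{(x,abxy;q)_\infty}, $$ where all the inner series and the outer series converge (absolutely). Moreover, for $y=1$ every ${}_3\phi_2$ on the left equals $1$, and the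 identity becomes the $q$-Gauss sum $$ {}_2\phi_1\left({a,b\atop abx};q,x\right)=\frac{(ax,bx;q)_\infty}{(x,abx;q)_\infty} $$ (in the usual notation, $c=abx$ and $x=c/(ab)$). -/

import Mathlib

/-- The finite `q`-shifted factorial `(a; q)_n = ∏_{k=0}^{n-1} (1 - a q^k)`. -/
def qPoch (a q : ℂ) (n : ℕ) : ℂ := ∏ k ∈ Finset.range n, (1 - a * q ^ k)

/-- The infinite `q`-shifted factorial `(a; q)_∞ = ∏_{k=0}^∞ (1 - a q^k)`
(the product converges for every `a` when `|q| < 1`). -/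
noncomputable def qPochInf (a q : ℂ) : ℂ := ∏' k : ℕ, (1 - a * q ^ k)

/-- The compact notation `(a₁, …, a_m; q)_n = (a₁; q)_n ⋯ (a_m; q)_n`. -/
def qPochs (as : List ℂ) (q : ℂ) (n : ℕ) : ℂ := (as.map fun a => qPoch a q n).prod

/-- The compact notation `(a₁, …, a_m; q)_∞ = (a₁; q)_∞ ⋯ (a_m; q)_∞`. -/
noncomputable def qPochsInf (as : List ℂ) (q : ℂ) : ℂ := (as.map fun a => qPochInf a q).prod

/-- The `k`-th term of the basic hypergeometric series `_rφ_s(as; bs; q, z)`, where `r` and `s` are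
the lengths of `as` and `bs`:
`(as; q)_k / (q, bs; q)_k * ((-1)^k q^{k(k-1)/2})^{1+s-r} * z^k`. -/
noncomputable def basicHypTerm (as bs : List ℂ) (q z : ℂ) (k : ℕ) : ℂ :=
  qPochs as q k / qPochs (q :: bs) q k *
    ((-1) ^ k * q ^ (k * (k - 1) / 2)) ^ (1 + (bs.length : ℤ) - (as.length : ℤ)) * z ^ k

/-- The basic hypergeometric series `_rφ_s(as; bs; q, z)`. -/
noncomputable def basicHyp (as bs : List ℂ) (q z : ℂ) : ℂ := ∑' k : ℕ, basicHypTerm as bs q z k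

open Finset hiding antidiagonal mem_antidiagonal
open Finset.HasAntidiagonal Filter Topology

/-! ### Finite q-identities -/

section FiniteIdentities

/-! Multiplied by `(abxy;q)_∞`, the claim becomes a sum of `x^n (abxy q^n;q)_∞ S_n`, where `S_n` is
a finite sum, polynomial in `a` and `b` (`mul_basicHyp_three_two`). A terminating transformation
(`sum_antidiagonal_transform`) rewrites `S_n` with `(ay;q)_k (bx)^k` in place of `(1/y;q)_k`. For
`|bx| < 1` the resulting double series is one iterated sum of an absolutely convergent triple
series; summing the other index first, by the q-binomial theorem, leaves convolutions equal to
`(1;q)_n/(q;q)_n`, so only `n = 0` survives (`hasSum_transformed`).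

The condition `|bx| < 1` is then removed by analytic continuation in `b` (`hasSum_expanded`): the
factor `q^(k(k-1)/2)` in `S_n` gives a majorant uniform for `b` in any disc
(`exists_summable_bound`). The condition `|abxy| < 1` keeps the denominators nonzero. -/

lemma qPoch_zero (a q : ℂ) : qPoch a q 0 = 1 := by simp [qPoch]

lemma qPoch_succ (a q : ℂ) (n : ℕ) : qPoch a q (n + 1) = qPoch a q n * (1 - a * q ^ n) := by
  simp [qPoch, prod_range_succ]

lemma qPoch_add (a q : ℂ) (m n : ℕ) :
    qPoch a q (m + n) = qPoch a q m * qPoch (a * q ^ m) q n := by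
  simp [qPoch, prod_range_add, pow_add, mul_assoc]

lemma qPoch_succ_left (a q : ℂ) (n : ℕ) : qPoch a q (n + 1) = (1 - a) * qPoch (a * q) q n := by
  rw [add_comm, qPoch_add]
  simp [qPoch]

lemma qPoch_one_succ (q : ℂ) (n : ℕ) : qPoch 1 q (n + 1) = 0 := by
  simp [qPoch_succ_left]

lemma qPoch_ne_zero {a q : ℂ} (h : ∀ k : ℕ, a * q ^ k ≠ 1) (n : ℕ) : qPoch a q n ≠ 0 :=
  prod_ne_zero_iff.2 fun k _ => sub_ne_zero.2 (h k).symm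

lemma mul_pow_ne_one {a q : ℂ} (ha : ‖a‖ < 1) (hq : ‖q‖ < 1) (k : ℕ) : a * q ^ k ≠ 1 := by
  intro h
  have h1 : ‖a * q ^ k‖ < 1 := by
    rw [norm_mul, norm_pow]
    exact mul_lt_one_of_nonneg_of_lt_one_left (norm_nonneg _) ha
      (pow_le_one₀ (norm_nonneg _) hq.le)
  simp [h] at h1

lemma qPoch_self_ne_zero {q : ℂ} (hq : ‖q‖ < 1) (n : ℕ) : qPoch q q n ≠ 0 :=
  qPoch_ne_zero (mul_pow_ne_one hq hq) n

lemma one_sub_pow_succ_ne_zero {q : ℂ} (hq : ‖q‖ < 1) (n : ℕ) : 1 - q ^ (n + 1) ≠ 0 := by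
  have := mul_pow_ne_one hq hq n
  rw [pow_succ']
  exact sub_ne_zero.2 this.symm

/-- The `q`-Chu–Vandermonde convolution. -/
lemma sum_antidiagonal_qPoch {q : ℂ} (hq : ‖q‖ < 1) (α γ : ℂ) (N : ℕ) :
    ∑ p ∈ antidiagonal N, qPoch α q p.1 * γ ^ p.1 / qPoch q q p.1 *
      (qPoch γ q p.2 / qPoch q q p.2) = qPoch (α * γ) q N / qPoch q q N := by
  induction N with
  | zero => simp [qPoch_zero]
  | succ N ih =>
    have hN := one_sub_pow_succ_ne_zero hq N
    have h0 := qPoch_self_ne_zero hq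
    set c : ℕ × ℕ → ℂ := fun p => qPoch α q p.1 * γ ^ p.1 / qPoch q q p.1 *
      (qPoch γ q p.2 / qPoch q q p.2) with hc
    have key : (1 - q ^ (N + 1)) * ∑ p ∈ antidiagonal (N + 1), c p =
        (1 - α * γ * q ^ N) * ∑ p ∈ antidiagonal N, c p := by
      -- With `i + j = N + 1`, `1 - q^(i+j) = (1 - q^j) + q^j (1 - q^i)`: each part kills one
      -- boundary term and cancels a factor of a denominator, so both shift to level `N`.
      have split : (1 - q ^ (N + 1)) * ∑ p ∈ antidiagonal (N + 1), c p =
          ∑ p ∈ antidiagonal (N + 1), (1 - q ^ p.2) * c p +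
          ∑ p ∈ antidiagonal (N + 1), q ^ p.2 * (1 - q ^ p.1) * c p := by
        rw [mul_sum, ← sum_add_distrib]
        refine sum_congr rfl fun p hp => ?_
        rw [← mem_antidiagonal.1 hp, pow_add]
        ring
      rw [split, Nat.sum_antidiagonal_succ', Nat.sum_antidiagonal_succ]
      simp only [pow_zero, sub_self, zero_mul, mul_zero, zero_add]
      rw [mul_sum, ← sum_add_distrib]
      refine sum_congr rfl fun p hp => ?_
      obtain ⟨i, j⟩ := p
      simp only [← mem_antidiagonal.1 hp, hc, qPoch_succ, pow_add, pow_one]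
      have h1 := h0 i
      have h2 := h0 j
      have h3 := one_sub_pow_succ_ne_zero hq i
      have h4 := one_sub_pow_succ_ne_zero hq j
      rw [pow_succ'] at h3 h4
      generalize q ^ i = u at *
      generalize q ^ j = v at *
      have h5 : 1 - u * q ≠ 0 := by rwa [mul_comm]
      have h6 : 1 - v * q ≠ 0 := by rwa [mul_comm]
      field_simp
      ring
    rw [ih] at key
    apply mul_left_cancel₀ hN
    rw [key, qPoch_succ, qPoch_succ, ← pow_succ']
    have := h0 N
    field_simp

/-- The terminating form of the `q`-Chu–Vandermonde sum with base inverted. -/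
lemma sum_antidiagonal_qPoch_inv {q : ℂ} (hq : ‖q‖ < 1) (D e : ℂ) (N : ℕ) :
    ∑ p ∈ antidiagonal N, qPoch D q p.1 * (-e) ^ p.1 * q ^ (p.1 * (p.1 - 1) / 2) /
      qPoch q q p.1 * (qPoch (D * e * q ^ p.1) q p.2 / qPoch q q p.2) =
      qPoch e q N / qPoch q q N := by
  induction N generalizing e with
  | zero => simp [qPoch_zero]
  | succ N ih =>
    have hN := one_sub_pow_succ_ne_zero hq N
    have h0 := qPoch_self_ne_zero hq
    set c : ℕ × ℕ → ℂ := fun p => qPoch D q p.1 * (-e) ^ p.1 * q ^ (p.1 * (p.1 - 1) / 2) /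
      qPoch q q p.1 * (qPoch (D * e * q ^ p.1) q p.2 / qPoch q q p.2) with hc
    have key : (1 - q ^ (N + 1)) * ∑ p ∈ antidiagonal (N + 1), c p =
        (1 - e) * (qPoch (e * q) q N / qPoch q q N) := by
      -- The opposite splitting, `q^i (1 - q^j) + (1 - q^i)`; the two parts recombine into the
      -- level-`N` sum at `e * q`, hence the induction over all `e`.
      have split : (1 - q ^ (N + 1)) * ∑ p ∈ antidiagonal (N + 1), c p =
          ∑ p ∈ antidiagonal (N + 1), q ^ p.1 * (1 - q ^ p.2) * c p +
          ∑ p ∈ antidiagonal (N + 1), (1 - q ^ p.1) * c p := by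
        rw [mul_sum, ← sum_add_distrib]
        refine sum_congr rfl fun p hp => ?_
        rw [← mem_antidiagonal.1 hp, pow_add]
        ring
      rw [split, Nat.sum_antidiagonal_succ', Nat.sum_antidiagonal_succ, ← ih]
      simp only [pow_zero, sub_self, zero_mul, mul_zero, zero_add]
      rw [mul_sum, ← sum_add_distrib]
      refine sum_congr rfl fun p hp => ?_
      obtain ⟨i, j⟩ := p
      simp only [hc, Nat.triangle_succ]
      rw [qPoch_succ_left _ q j, qPoch_succ, qPoch_succ, qPoch_succ]
      have e1 : D * e * q ^ i * q = D * e * q ^ (i + 1) := by ring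
      have e2 : D * (e * q) * q ^ i = D * e * q ^ (i + 1) := by ring
      have e3 : (-(e * q)) ^ i = (-e) ^ i * q ^ i := by rw [← mul_pow]; ring
      rw [e1, e2, e3, pow_add q _ i, pow_succ (-e), pow_succ q i, pow_succ q j]
      have h1 := h0 i
      have h2 := h0 j
      have h3 := one_sub_pow_succ_ne_zero hq i
      have h4 := one_sub_pow_succ_ne_zero hq j
      rw [pow_succ'] at h3 h4
      generalize q ^ i = u at *
      generalize q ^ j = v at *
      have h5 : 1 - u * q ≠ 0 := by rwa [mul_comm]
      have h6 : 1 - v * q ≠ 0 := by rwa [mul_comm]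
      field_simp
      ring
    apply mul_left_cancel₀ hN
    rw [key, qPoch_succ_left, qPoch_succ, ← pow_succ']
    have := h0 N
    field_simp

lemma sum_antidiagonal_assoc {M : Type*} [AddCommMonoid M] (n : ℕ) (f : ℕ → ℕ → ℕ → M) :
    ∑ p ∈ antidiagonal n, ∑ r ∈ antidiagonal p.1, f r.1 r.2 p.2 =
      ∑ p ∈ antidiagonal n, ∑ r ∈ antidiagonal p.2, f p.1 r.1 r.2 := by
  rw [sum_sigma', sum_sigma']
  refine sum_bij' (fun z _ => ⟨(z.2.1, z.2.2 + z.1.2), (z.2.2, z.1.2)⟩)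
    (fun z _ => ⟨(z.1.1 + z.2.1, z.2.2), (z.1.1, z.2.1)⟩) ?_ ?_ ?_ ?_ ?_
  all_goals
    rintro ⟨⟨a, b⟩, ⟨c, d⟩⟩ h
    simp only [mem_sigma, mem_antidiagonal] at h
    obtain ⟨rfl, rfl⟩ := h
    simp [add_assoc]

/-- The transformation of a terminating `₃φ₂`, in denominator-free form. -/
lemma sum_antidiagonal_transform {q : ℂ} (hq : ‖q‖ < 1) (a b : ℂ) {x y : ℂ} (hx : x ≠ 0)
    (hy : y ≠ 0) (n : ℕ) :
    ∑ p ∈ antidiagonal n, qPoch (1 / x) q p.1 * qPoch (a * y) q p.1 * (b * x) ^ p.1 /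
      qPoch q q p.1 * (qPoch (a * q ^ p.1) q p.2 * qPoch (b * x) q p.2 / qPoch q q p.2) =
    ∑ p ∈ antidiagonal n, qPoch (1 / x) q p.1 * qPoch (1 / y) q p.1 * (-(a * b * x * y)) ^ p.1 *
      q ^ (p.1 * (p.1 - 1) / 2) / qPoch q q p.1 *
      (qPoch (a * q ^ p.1) q p.2 * qPoch (b * q ^ p.1) q p.2 / qPoch q q p.2) := by
  have hay : 1 / y * (a * y) = a := by field_simp
  -- Expand `(ay;q)_k` by the inverted Vandermonde sum with `D = 1/y`; after regrouping, the inner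
  -- sum is an ordinary Vandermonde convolution.
  have hL : ∀ p ∈ antidiagonal n,
      qPoch (1 / x) q p.1 * qPoch (a * y) q p.1 * (b * x) ^ p.1 / qPoch q q p.1 *
        (qPoch (a * q ^ p.1) q p.2 * qPoch (b * x) q p.2 / qPoch q q p.2) =
      ∑ r ∈ antidiagonal p.1, qPoch (1 / x) q (r.1 + r.2) * (b * x) ^ (r.1 + r.2) *
        (qPoch (1 / y) q r.1 * (-(a * y)) ^ r.1 * q ^ (r.1 * (r.1 - 1) / 2) / qPoch q q r.1 *
          (qPoch (a * q ^ r.1) q r.2 / qPoch q q r.2)) *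
        (qPoch (a * q ^ (r.1 + r.2)) q p.2 * qPoch (b * x) q p.2 / qPoch q q p.2) := by
    intro p _
    have h := sum_antidiagonal_qPoch_inv hq (1 / y) (a * y) p.1
    rw [hay] at h
    have e : qPoch (1 / x) q p.1 * qPoch (a * y) q p.1 * (b * x) ^ p.1 / qPoch q q p.1 =
      qPoch (1 / x) q p.1 * (b * x) ^ p.1 * (qPoch (a * y) q p.1 / qPoch q q p.1) := by ring
    rw [e, ← h, mul_sum, sum_mul]
    refine sum_congr rfl fun r hr => ?_
    rw [mem_antidiagonal.1 hr]
  rw [sum_congr rfl hL, sum_antidiagonal_assoc n fun j i m =>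
    qPoch (1 / x) q (j + i) * (b * x) ^ (j + i) *
      (qPoch (1 / y) q j * (-(a * y)) ^ j * q ^ (j * (j - 1) / 2) / qPoch q q j *
        (qPoch (a * q ^ j) q i / qPoch q q i)) *
      (qPoch (a * q ^ (j + i)) q m * qPoch (b * x) q m / qPoch q q m)]
  refine sum_congr rfl fun p _ => ?_
  obtain ⟨j, N⟩ := p
  have h := sum_antidiagonal_qPoch hq (1 / x * q ^ j) (b * x) N
  have e : 1 / x * q ^ j * (b * x) = b * q ^ j := by field_simp
  rw [e] at h
  simp only
  rw [mul_div_assoc (qPoch (a * q ^ j) q N), ← h, mul_sum, mul_sum]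
  refine sum_congr rfl fun r hr => ?_
  have e1 : (-(a * b * x * y)) ^ j = (-(a * y)) ^ j * (b * x) ^ j := by
    rw [← mul_pow]
    ring
  rw [← mem_antidiagonal.1 hr, qPoch_add (a * q ^ j), qPoch_add (1 / x), pow_add, e1,
    mul_assoc a, ← pow_add]
  ring_nf

end FiniteIdentities

/-! ### Infinite products and the q-binomial theorem -/

section Analysis

variable {q : ℂ}

lemma summable_norm_mul_pow (hq : ‖q‖ < 1) (a : ℂ) : Summable fun k : ℕ => ‖-(a * q ^ k)‖ := by
  simpa using (summable_geometric_of_lt_one (norm_nonneg q) hq).mul_left ‖a‖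

lemma norm_qPoch_le (hq : ‖q‖ < 1) {a : ℂ} {r : ℝ} (ha : ‖a‖ ≤ r) (n : ℕ) :
    ‖qPoch a q n‖ ≤ Real.exp (r / (1 - ‖q‖)) := by
  have hg := summable_geometric_of_lt_one (norm_nonneg q) hq
  calc ‖qPoch a q n‖ = ∏ k ∈ range n, ‖1 - a * q ^ k‖ := by simp [qPoch, norm_prod]
    _ ≤ ∏ k ∈ range n, Real.exp (r * ‖q‖ ^ k) := by
        refine prod_le_prod (fun _ _ => norm_nonneg _) fun k _ => ?_
        calc ‖1 - a * q ^ k‖ ≤ 1 + ‖a‖ * ‖q‖ ^ k := by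
              simpa using norm_sub_le (1 : ℂ) (a * q ^ k)
          _ ≤ r * ‖q‖ ^ k + 1 := by
              rw [add_comm]
              gcongr
          _ ≤ _ := Real.add_one_le_exp _
    _ = Real.exp (r * ∑ k ∈ range n, ‖q‖ ^ k) := by rw [← Real.exp_sum, mul_sum]
    _ ≤ _ := by
        rw [div_eq_mul_inv, ← tsum_geometric_of_lt_one (norm_nonneg q) hq]
        have := (norm_nonneg a).trans ha
        gcongr
        exact hg.sum_le_tsum _ fun _ _ => by positivity

lemma tendsto_qPoch (hq : ‖q‖ < 1) (a : ℂ) :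
    Tendsto (qPoch a q) atTop (𝓝 (qPochInf a q)) := by
  have h : Multipliable fun k : ℕ => 1 - a * q ^ k := by
    simpa [sub_eq_add_neg] using multipliable_one_add_of_summable (summable_norm_mul_pow hq a)
  exact h.hasProd.tendsto_prod_nat

lemma norm_qPochInf_le (hq : ‖q‖ < 1) {a : ℂ} {r : ℝ} (ha : ‖a‖ ≤ r) :
    ‖qPochInf a q‖ ≤ Real.exp (r / (1 - ‖q‖)) :=
  le_of_tendsto' (tendsto_qPoch hq a).norm (norm_qPoch_le hq ha)

lemma qPochInf_eq_mul (hq : ‖q‖ < 1) (a : ℂ) (n : ℕ) :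
    qPochInf a q = qPoch a q n * qPochInf (a * q ^ n) q := by
  refine tendsto_nhds_unique ((tendsto_add_atTop_iff_nat n).2 (tendsto_qPoch hq a)) ?_
  simp_rw [add_comm _ n, qPoch_add]
  exact (tendsto_qPoch hq _).const_mul _

lemma qPochInf_ne_zero (hq : ‖q‖ < 1) {a : ℂ} (ha : ∀ k : ℕ, a * q ^ k ≠ 1) :
    qPochInf a q ≠ 0 := by
  have h := tprod_one_add_ne_zero_of_summable (f := fun k : ℕ => -(a * q ^ k))
    (fun k => by simpa [← sub_eq_add_neg] using sub_ne_zero.2 (ha k).symm)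
    (summable_norm_mul_pow hq a)
  simpa [qPochInf, sub_eq_add_neg] using h

lemma differentiable_qPochInf (hq : ‖q‖ < 1) : Differentiable ℂ fun a => qPochInf a q := by
  intro a
  have hu := (summable_geometric_of_lt_one (norm_nonneg q) hq).mul_left (‖a‖ + 1)
  have h := Summable.hasProdLocallyUniformlyOn_nat_one_add (K := Metric.ball (0 : ℂ) (‖a‖ + 1))
    (f := fun (k : ℕ) (z : ℂ) => -(z * q ^ k)) Metric.isOpen_ball hu
    (.of_forall fun k z hz => by
      rw [norm_neg, norm_mul, norm_pow]
      have : ‖z‖ < ‖a‖ + 1 := by simpa using hz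
      gcongr) (fun k => by fun_prop)
  have hd := h.differentiableOn (.of_forall fun s => by
    simpa [Finset.prod_fn] using DifferentiableOn.finsetProd (fun _ _ => by fun_prop))
      Metric.isOpen_ball
  have := hd.differentiableAt (x := a) (Metric.isOpen_ball.mem_nhds (by simp))
  simpa [qPochInf, sub_eq_add_neg] using this

lemma exists_norm_inv_qPoch_le (hq : ‖q‖ < 1) : ∃ C : ℝ, 0 < C ∧ ∀ n, ‖(qPoch q q n)⁻¹‖ ≤ C := by
  have h := ((tendsto_qPoch hq q).inv₀ (qPochInf_ne_zero hq (mul_pow_ne_one hq hq))).norm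
  obtain ⟨C, hC⟩ := h.bddAbove_range
  exact ⟨max C 1, by positivity, fun n => (hC ⟨n, rfl⟩).trans (le_max_left _ _)⟩

/-- The `q`-binomial theorem. -/
lemma hasSum_qBinomial (hq : ‖q‖ < 1) (α : ℂ) {t : ℂ} (ht : ‖t‖ < 1) :
    HasSum (fun n => qPoch α q n / qPoch q q n * t ^ n) (qPochInf (α * t) q / qPochInf t q) := by
  obtain ⟨C, hC0, hC⟩ := exists_norm_inv_qPoch_le hq
  set c : ℕ → ℂ := fun n => qPoch α q n / qPoch q q n with hc
  have hcb : ∀ n, ‖c n‖ ≤ Real.exp (‖α‖ / (1 - ‖q‖)) * C := fun n => by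
    rw [show c n = qPoch α q n * (qPoch q q n)⁻¹ from div_eq_mul_inv _ _, norm_mul]
    exact mul_le_mul (norm_qPoch_le hq le_rfl n) (hC n) (norm_nonneg _) (Real.exp_nonneg _)
  have hb : Summable fun n : ℕ => Real.exp (‖α‖ / (1 - ‖q‖)) * C * ‖t‖ ^ n :=
    (summable_geometric_of_lt_one (norm_nonneg t) ht).mul_left _
  have hle : ∀ s : ℂ, ‖s‖ ≤ ‖t‖ → ∀ n,
      ‖c n * s ^ n‖ ≤ Real.exp (‖α‖ / (1 - ‖q‖)) * C * ‖t‖ ^ n := fun s hs n => by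
    rw [norm_mul, norm_pow]
    have := hcb n
    gcongr
  have hsum : ∀ s : ℂ, ‖s‖ ≤ ‖t‖ → Summable fun n => c n * s ^ n := fun s hs =>
    hb.of_norm_bounded (hle s hs)
  have hrec : ∀ n, c (n + 1) * (1 - q ^ (n + 1)) = c n * (1 - α * q ^ n) := fun n => by
    have h1 := one_sub_pow_succ_ne_zero hq n
    have h2 := qPoch_self_ne_zero hq n
    simp only [hc, qPoch_succ, ← pow_succ']
    field_simp
  -- The functional equation `(1 - s) f(s) = (1 - αs) f(qs)`; iterating it sends the argument to
  -- `0`, where `f = 1`.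
  have hstep : ∀ s : ℂ, ‖s‖ ≤ ‖t‖ →
      (1 - s) * ∑' n, c n * s ^ n = (1 - α * s) * ∑' n, c n * (s * q) ^ n := by
    intro s hs
    have hsq : ‖s * q‖ ≤ ‖t‖ := by
      rw [norm_mul]
      exact (mul_le_of_le_one_right (norm_nonneg _) hq.le).trans hs
    have h1 := hsum s hs
    have h2 := hsum _ hsq
    have e1 := h1.tsum_eq_zero_add
    have e2 := h2.tsum_eq_zero_add
    have h1' := (summable_nat_add_iff 1).2 h1
    have h2' := (summable_nat_add_iff 1).2 h2
    have e : ∑' n, c (n + 1) * s ^ (n + 1) - s * ∑' n, c n * s ^ n =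
        ∑' n, c (n + 1) * (s * q) ^ (n + 1) - α * s * ∑' n, c n * (s * q) ^ n := by
      rw [← tsum_mul_left, ← tsum_mul_left, ← h1'.tsum_sub (h1.mul_left _),
        ← h2'.tsum_sub (h2.mul_left _)]
      refine tsum_congr fun n => ?_
      linear_combination s ^ (n + 1) * hrec n
    linear_combination e + e1 - e2
  have hiter : ∀ n, qPoch t q n * ∑' k, c k * t ^ k =
      qPoch (α * t) q n * ∑' k, c k * (t * q ^ n) ^ k := by
    intro n
    induction n with
    | zero => simp [qPoch_zero]
    | succ n ih =>
      have hn : ‖t * q ^ n‖ ≤ ‖t‖ := by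
        rw [norm_mul, norm_pow]
        exact mul_le_of_le_one_right (norm_nonneg _) (pow_le_one₀ (norm_nonneg _) hq.le)
      have := hstep _ hn
      rw [qPoch_succ, qPoch_succ, pow_succ, ← mul_assoc t]
      linear_combination (1 - t * q ^ n) * ih + qPoch (α * t) q n * this
  have hlim : Tendsto (fun n => ∑' k, c k * (t * q ^ n) ^ k) atTop (𝓝 (∑' k, c k * 0 ^ k)) := by
    refine tendsto_tsum_of_dominated_convergence hb (fun k => ?_) (.of_forall fun n k => ?_)
    · refine Tendsto.const_mul _ (Tendsto.pow ?_ k)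
      simpa using (tendsto_pow_atTop_nhds_zero_of_norm_lt_one hq).const_mul t
    · refine hle _ ?_ k
      rw [norm_mul, norm_pow]
      exact mul_le_of_le_one_right (norm_nonneg _) (pow_le_one₀ (norm_nonneg _) hq.le)
  have h0 : ∑' k, c k * 0 ^ k = 1 := by
    rw [tsum_eq_single 0 fun k hk => by simp [hk]]
    simp [hc, qPoch_zero]
  rw [h0] at hlim
  have heq := tendsto_nhds_unique
    (((tendsto_qPoch hq t).mul_const (∑' k, c k * t ^ k)).congr hiter)
    ((tendsto_qPoch hq (α * t)).mul hlim)
  have hne := qPochInf_ne_zero hq (mul_pow_ne_one ht hq)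
  rw [show qPochInf (α * t) q / qPochInf t q = ∑' k, c k * t ^ k by
    rw [div_eq_iff hne]
    linear_combination -heq]
  exact (hsum t le_rfl).hasSum

lemma HasSum.of_eq {ι : Type*} {f g : ι → ℂ} {s t : ℂ} (h : HasSum f s) (hf : ∀ i, g i = f i)
    (hs : t = s) : HasSum g t := by
  rwa [hs, funext hf]

lemma HasSum.sum_antidiagonal {f : ℕ × ℕ → ℂ} {s : ℂ} (h : HasSum f s) :
    HasSum (fun n => ∑ p ∈ antidiagonal n, f p) s := by
  have h1 := (sigmaAntidiagonalEquivProd (A := ℕ)).hasSum_iff.2 h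
  refine h1.sigma fun n => ?_
  rw [← sum_coe_sort]
  exact hasSum_fintype _

end Analysis

/-! ### The triple series -/

section Main

variable {q : ℂ}

lemma hasSum_transformed (hq : ‖q‖ < 1) (a b : ℂ) {x : ℂ} (y : ℂ) (hx0 : x ≠ 0) (hx : ‖x‖ < 1)
    (hbx : ‖b * x‖ < 1) :
    HasSum (fun p : ℕ × ℕ => x ^ (p.1 + p.2) * qPochInf (a * b * x * y * q ^ (p.1 + p.2)) q *
      (qPoch (1 / x) q p.1 * qPoch (a * y) q p.1 * (b * x) ^ p.1 / qPoch q q p.1 *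
        (qPoch (a * q ^ p.1) q p.2 * qPoch (b * x) q p.2 / qPoch q q p.2)))
      (qPochInf (a * x) q * qPochInf (b * x) q / qPochInf x q) := by
  obtain ⟨C, hC0, hC⟩ := exists_norm_inv_qPoch_le hq
  set E : ℂ → ℝ := fun z => Real.exp (‖z‖ / (1 - ‖q‖)) with hE
  have hP : ∀ z n, ‖qPoch z q n‖ ≤ E z := fun z n => norm_qPoch_le hq le_rfl n
  have hpow : ∀ n : ℕ, ‖q ^ n‖ ≤ 1 := fun n => by
    rw [norm_pow]
    exact pow_le_one₀ (norm_nonneg _) hq.le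
  have hmul : ∀ (z : ℂ) (n : ℕ), ‖z * q ^ n‖ ≤ ‖z‖ := fun z n => by
    rw [norm_mul]
    exact mul_le_of_le_one_right (norm_nonneg _) (hpow n)
  have hE0 : ∀ z, 0 ≤ E z := fun z => Real.exp_nonneg _
  -- Indices `((k, m), j)`: the sum over `j` is q-binomial at `b x q^m`, the sum over `m` is
  -- q-binomial at `x q^j`.
  set T : (ℕ × ℕ) × ℕ → ℂ := fun z => qPochInf (b * x) q *
    (qPoch (1 / x) q z.1.1 * (b * x) ^ z.1.1 * x ^ z.1.1 * (qPoch q q z.1.1)⁻¹) *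
    (qPoch (a * y) q (z.1.1 + z.2) * (b * x * q ^ z.1.2) ^ z.2 * (qPoch q q z.2)⁻¹) *
    (qPoch (a * q ^ z.1.1) q z.1.2 * x ^ z.1.2 * (qPoch q q z.1.2)⁻¹) with hT
  have hTsum : Summable T := by
    have hg := summable_geometric_of_lt_one (norm_nonneg _) hbx
    have hgx := summable_geometric_of_lt_one (norm_nonneg _) hx
    have h := ((hg.mul_of_nonneg hgx (fun _ => by positivity) (fun _ => by positivity)).mul_of_nonneg
      hg (fun _ => by positivity) (fun _ => by positivity)).mul_left
      (E (b * x) * (E (1 / x) * C) * (E (a * y) * C) * (E a * C))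
    refine h.of_norm_bounded ?_
    rintro ⟨⟨k, m⟩, j⟩
    have h1 : ‖qPoch (1 / x) q k * (b * x) ^ k * x ^ k * (qPoch q q k)⁻¹‖ ≤
        E (1 / x) * ‖b * x‖ ^ k * 1 * C := by
      rw [norm_mul, norm_mul, norm_mul, norm_pow, norm_pow]
      have := hP (1 / x) k
      have := hC k
      have : ‖x‖ ^ k ≤ 1 := pow_le_one₀ (norm_nonneg _) hx.le
      gcongr
    have h2 : ‖qPoch (a * y) q (k + j) * (b * x * q ^ m) ^ j * (qPoch q q j)⁻¹‖ ≤
        E (a * y) * ‖b * x‖ ^ j * C := by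
      rw [norm_mul, norm_mul, norm_pow]
      have := hP (a * y) (k + j)
      have := hC j
      have := hmul (b * x) m
      gcongr
    have h3 : ‖qPoch (a * q ^ k) q m * x ^ m * (qPoch q q m)⁻¹‖ ≤ E a * ‖x‖ ^ m * C := by
      rw [norm_mul, norm_mul, norm_pow]
      have := norm_qPoch_le hq (hmul a k) m
      have := hC m
      gcongr
    have h4 : ‖qPochInf (b * x) q‖ ≤ E (b * x) := norm_qPochInf_le hq le_rfl
    simp only [hT]
    rw [norm_mul, norm_mul, norm_mul]
    calc _ ≤ E (b * x) * (E (1 / x) * ‖b * x‖ ^ k * 1 * C) * (E (a * y) * ‖b * x‖ ^ j * C) *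
          (E a * ‖x‖ ^ m * C) := by gcongr
      _ = _ := by ring
  have hxne := qPochInf_ne_zero hq (mul_pow_ne_one hx hq)
  have hfib := hTsum.hasSum.prod_fiberwise (g := fun p : ℕ × ℕ =>
      x ^ (p.1 + p.2) * qPochInf (a * b * x * y * q ^ (p.1 + p.2)) q *
      (qPoch (1 / x) q p.1 * qPoch (a * y) q p.1 * (b * x) ^ p.1 / qPoch q q p.1 *
        (qPoch (a * q ^ p.1) q p.2 * qPoch (b * x) q p.2 / qPoch q q p.2))) (by
    rintro ⟨k, m⟩
    have ht : ‖b * x * q ^ m‖ < 1 := (hmul _ _).trans_lt hbx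
    have h := (hasSum_qBinomial hq (a * y * q ^ k) ht).mul_left (qPochInf (b * x) q *
      (qPoch (1 / x) q k * (b * x) ^ k * x ^ k * (qPoch q q k)⁻¹) * qPoch (a * y) q k *
      (qPoch (a * q ^ k) q m * x ^ m * (qPoch q q m)⁻¹))
    have hne := qPochInf_ne_zero hq (mul_pow_ne_one ht hq)
    refine h.of_eq (fun j => ?_) ?_
    · simp only [hT, qPoch_add (a * y), div_eq_mul_inv]
      ring
    · simp only
      rw [qPochInf_eq_mul hq (b * x) m,
        show a * y * q ^ k * (b * x * q ^ m) = a * b * x * y * q ^ (k + m) by ring]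
      field_simp
      ring)
  -- Exchanges `m` and `j`, so that `m` is summed first.
  set e : (ℕ × ℕ) × ℕ ≃ (ℕ × ℕ) × ℕ :=
    ⟨fun z => ((z.1.1, z.2), z.1.2), fun z => ((z.1.1, z.2), z.1.2), fun _ => rfl, fun _ => rfl⟩
  have hfib' := (e.hasSum_iff.2 hTsum.hasSum).prod_fiberwise (g := fun p : ℕ × ℕ =>
      qPochInf (b * x) q / qPochInf x q * (qPoch (a * y) q (p.1 + p.2) * (b * x) ^ (p.1 + p.2) *
        qPochInf (a * x * q ^ (p.1 + p.2)) q) *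
      (qPoch (1 / x) q p.1 * x ^ p.1 / qPoch q q p.1 * (qPoch x q p.2 / qPoch q q p.2))) (by
    rintro ⟨k, j⟩
    have ht : ‖x * q ^ j‖ < 1 := (hmul _ _).trans_lt hx
    have h := (hasSum_qBinomial hq (a * q ^ k) ht).mul_left (qPochInf (b * x) q *
      (qPoch (1 / x) q k * (b * x) ^ k * x ^ k * (qPoch q q k)⁻¹) *
      (qPoch (a * y) q (k + j) * (b * x) ^ j * (qPoch q q j)⁻¹))
    have hne := qPochInf_ne_zero hq (mul_pow_ne_one ht hq)
    have hne' : qPoch x q j ≠ 0 := qPoch_ne_zero (mul_pow_ne_one hx hq) j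
    refine h.of_eq (fun m => ?_) ?_
    · simp only [hT, e, Function.comp_apply, Equiv.coe_fn_mk, div_eq_mul_inv]
      ring
    · rw [qPochInf_eq_mul hq x j] at hxne
      simp only
      rw [qPochInf_eq_mul hq x j,
        show a * q ^ k * (x * q ^ j) = a * x * q ^ (k + j) by ring]
      field_simp
      ring)
  have hone : HasSum (fun n : ℕ => ∑ p ∈ antidiagonal n,
      qPochInf (b * x) q / qPochInf x q * (qPoch (a * y) q (p.1 + p.2) * (b * x) ^ (p.1 + p.2) *
        qPochInf (a * x * q ^ (p.1 + p.2)) q) *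
      (qPoch (1 / x) q p.1 * x ^ p.1 / qPoch q q p.1 * (qPoch x q p.2 / qPoch q q p.2)))
      (qPochInf (a * x) q * qPochInf (b * x) q / qPochInf x q) := by
    have hn : ∀ n : ℕ, ∑ p ∈ antidiagonal n,
        qPochInf (b * x) q / qPochInf x q * (qPoch (a * y) q (p.1 + p.2) * (b * x) ^ (p.1 + p.2) *
          qPochInf (a * x * q ^ (p.1 + p.2)) q) *
        (qPoch (1 / x) q p.1 * x ^ p.1 / qPoch q q p.1 * (qPoch x q p.2 / qPoch q q p.2)) =
        qPochInf (b * x) q / qPochInf x q * (qPoch (a * y) q n * (b * x) ^ n *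
          qPochInf (a * x * q ^ n) q) * (qPoch 1 q n / qPoch q q n) := by
      intro n
      -- The product of the parameters `1/x` and `x` is `1`, and `(1;q)_n = 0` for `n > 0`.
      have h := sum_antidiagonal_qPoch hq (1 / x) x n
      rw [one_div_mul_cancel hx0] at h
      rw [← h, mul_sum]
      refine sum_congr rfl fun p hp => ?_
      rw [mem_antidiagonal.1 hp]
    simp_rw [hn]
    convert hasSum_single 0 fun n hn0 => ?_ using 1
    · simp [qPoch_zero]
      ring
    · obtain ⟨m, rfl⟩ := Nat.exists_eq_succ_of_ne_zero hn0
      simp [qPoch_one_succ]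
  rwa [hfib'.sum_antidiagonal.unique hone] at hfib

/-! ### Analytic continuation in `b` -/

/-- The general term of the double series obtained by expanding each `₃φ₂`. -/
noncomputable def expandedTerm (q a x y b : ℂ) (p : ℕ × ℕ) : ℂ :=
  qPoch (1 / x) q p.1 * qPoch (1 / y) q p.1 * (-(a * b * x * y)) ^ p.1 *
    q ^ (p.1 * (p.1 - 1) / 2) / qPoch q q p.1 *
    (qPoch (a * q ^ p.1) q p.2 * qPoch (b * q ^ p.1) q p.2 / qPoch q q p.2)

lemma summable_pow_mul_pow_triangle (hq0 : q ≠ 0) (hq : ‖q‖ < 1) {r : ℝ} (hr : 0 < r) :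
    Summable fun k : ℕ => r ^ k * ‖q‖ ^ (k * (k - 1) / 2) := by
  have hq' : 0 < ‖q‖ := norm_pos_iff.2 hq0
  refine summable_of_ratio_test_tendsto_lt_one zero_lt_one (.of_forall fun k => by positivity) ?_
  have h : ∀ k : ℕ, ‖r ^ (k + 1) * ‖q‖ ^ ((k + 1) * (k + 1 - 1) / 2)‖ /
      ‖r ^ k * ‖q‖ ^ (k * (k - 1) / 2)‖ = r * ‖q‖ ^ k := fun k => by
    rw [Nat.triangle_succ, Real.norm_of_nonneg (by positivity),
      Real.norm_of_nonneg (by positivity), pow_add ‖q‖, pow_succ]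
    field_simp
  simp_rw [h]
  simpa using (tendsto_pow_atTop_nhds_zero_of_lt_one (norm_nonneg q) hq).const_mul r

/-- All q-factorials are bounded uniformly, so the terms are dominated by the convolution of `L^k
|q|^(k(k-1)/2)`, summable for every `L > 0`, with the geometric series in `|x|`. -/
lemma exists_summable_bound (hq0 : q ≠ 0) (hq : ‖q‖ < 1) (a : ℂ) {x : ℂ} (y : ℂ) (hx : ‖x‖ < 1)
    {R : ℝ} (hR : 0 < R) :
    ∃ u : ℕ → ℝ, Summable u ∧ ∀ n b, ‖b‖ ≤ R → ‖x ^ n * qPochInf (a * b * x * y * q ^ n) q *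
      ∑ p ∈ antidiagonal n, expandedTerm q a x y b p‖ ≤ u n := by
  obtain ⟨C, hC0, hC⟩ := exists_norm_inv_qPoch_le hq
  set E : ℝ → ℝ := fun r => Real.exp (r / (1 - ‖q‖)) with hE
  have hmul : ∀ (z : ℂ) (n : ℕ), ‖z * q ^ n‖ ≤ ‖z‖ := fun z n => by
    rw [norm_mul, norm_pow]
    exact mul_le_of_le_one_right (norm_nonneg _) (pow_le_one₀ (norm_nonneg _) hq.le)
  have hE0 : ∀ z, 0 ≤ E z := fun z => Real.exp_nonneg _
  -- The `+ 1` makes `L` positive even when `a` or `y` vanishes.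
  set L : ℝ := ‖a‖ * R * ‖x‖ * ‖y‖ + 1 with hL
  have hL0 : 0 < L := by positivity
  set K : ℝ := E L * (E ‖1 / x‖ * E ‖1 / y‖ * C * (E ‖a‖ * E R * C)) with hK
  have hs := summable_norm_sum_mul_antidiagonal_of_summable_norm
    (f := fun k : ℕ => L ^ k * ‖q‖ ^ (k * (k - 1) / 2)) (g := fun m : ℕ => ‖x‖ ^ m)
    (summable_pow_mul_pow_triangle hq0 hq hL0).norm
    (summable_geometric_of_lt_one (norm_nonneg x) hx).norm
  refine ⟨_, hs.of_norm.mul_left K, fun n b hb => ?_⟩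
  have hw : ‖a * b * x * y‖ ≤ L := by
    rw [norm_mul, norm_mul, norm_mul, hL]
    have : ‖a‖ * ‖b‖ * ‖x‖ * ‖y‖ ≤ ‖a‖ * R * ‖x‖ * ‖y‖ := by gcongr
    linarith
  rw [mul_sum, mul_sum]
  refine norm_sum_le_of_le _ fun p hp => ?_
  obtain ⟨k, m⟩ := p
  have h1 : ‖qPochInf (a * b * x * y * q ^ n) q‖ ≤ E L :=
    norm_qPochInf_le hq ((hmul _ _).trans hw)
  have h2 : ‖qPoch (1 / x) q k‖ ≤ E ‖1 / x‖ := norm_qPoch_le hq le_rfl k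
  have h3 : ‖qPoch (1 / y) q k‖ ≤ E ‖1 / y‖ := norm_qPoch_le hq le_rfl k
  have h4 : ‖qPoch (a * q ^ k) q m‖ ≤ E ‖a‖ := norm_qPoch_le hq (hmul _ _) m
  have h5 : ‖qPoch (b * q ^ k) q m‖ ≤ E R := norm_qPoch_le hq ((hmul _ _).trans hb) m
  have h6 := hC k
  have h7 := hC m
  have h8 : ‖x‖ ^ n ≤ ‖x‖ ^ m :=
    pow_le_pow_of_le_one (norm_nonneg _) hx.le (Nat.le.intro (add_comm m k ▸ mem_antidiagonal.1 hp))
  simp only [expandedTerm, div_eq_mul_inv (_ * _) (qPoch _ _ _), norm_mul,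
    norm_pow, norm_neg]
  calc _ ≤ ‖x‖ ^ m * E L * (E ‖1 / x‖ * E ‖1 / y‖ * L ^ k * ‖q‖ ^ (k * (k - 1) / 2) * C *
        (E ‖a‖ * E R * C)) := by
        simp only [norm_mul] at hw
        gcongr
    _ = _ := by
        rw [hK]
        ring

/-- Both sides are holomorphic in `b` on a disc about `0` containing the given value and agree on
the unit disc, so the identity theorem applies. -/
lemma hasSum_expanded (hq0 : q ≠ 0) (hq : ‖q‖ < 1) (a b : ℂ) {x y : ℂ} (hx0 : x ≠ 0)
    (hy0 : y ≠ 0) (hx : ‖x‖ < 1) :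
    HasSum (fun n : ℕ => x ^ n * qPochInf (a * b * x * y * q ^ n) q *
      ∑ p ∈ antidiagonal n, expandedTerm q a x y b p)
      (qPochInf (a * x) q * qPochInf (b * x) q / qPochInf x q) := by
  set R : ℝ := ‖b‖ + 1 with hR
  obtain ⟨u, hu, hle⟩ := exists_summable_bound hq0 hq a y hx (R := R) (by positivity)
  have hd := differentiable_qPochInf hq
  have hdp : ∀ n : ℕ, Differentiable ℂ fun z => qPoch z q n := fun n => by
    unfold qPoch
    fun_prop
  have hF : DifferentiableOn ℂ (fun z => ∑' n : ℕ, x ^ n * qPochInf (a * z * x * y * q ^ n) q *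
      ∑ p ∈ antidiagonal n, expandedTerm q a x y z p) (Metric.ball 0 R) := by
    refine Complex.differentiableOn_tsum_of_summable_norm hu (fun n => ?_) Metric.isOpen_ball
      fun n z hz => hle n z (by simpa using (Metric.mem_ball.1 hz).le)
    have h1 : Differentiable ℂ fun z => qPochInf (a * z * x * y * q ^ n) q :=
      hd.comp (g := fun z => qPochInf z q) (by fun_prop)
    have h2 : ∀ p, Differentiable ℂ fun z => expandedTerm q a x y z p := fun p => by
      have : Differentiable ℂ fun z => qPoch (z * q ^ p.1) q p.2 :=
        (hdp p.2).comp (g := fun z => qPoch z q p.2) (by fun_prop)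
      unfold expandedTerm
      fun_prop
    exact Differentiable.differentiableOn (by fun_prop)
  have hG : DifferentiableOn ℂ (fun z => qPochInf (a * x) q * qPochInf (z * x) q / qPochInf x q)
      (Metric.ball 0 R) := by
    have : Differentiable ℂ fun z => qPochInf (z * x) q :=
      hd.comp (g := fun z => qPochInf z q) (by fun_prop)
    exact Differentiable.differentiableOn (by fun_prop)
  have hnear : ∀ z : ℂ, ‖z‖ < 1 → ∑' n : ℕ, x ^ n * qPochInf (a * z * x * y * q ^ n) q *
      ∑ p ∈ antidiagonal n, expandedTerm q a x y z p =
      qPochInf (a * x) q * qPochInf (z * x) q / qPochInf x q := by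
    intro z hz
    have hzx : ‖z * x‖ < 1 := by
      rw [norm_mul]
      exact mul_lt_one_of_nonneg_of_lt_one_left (norm_nonneg _) hz hx.le
    refine HasSum.tsum_eq ?_
    convert (hasSum_transformed hq a z y hx0 hx hzx).sum_antidiagonal using 1
    funext n
    have := sum_antidiagonal_transform hq a z hx0 hy0 n
    simp only [expandedTerm]
    rw [← this, mul_sum]
    refine sum_congr rfl fun p hp => ?_
    rw [mem_antidiagonal.1 hp]
  have heq := (hF.analyticOnNhd Metric.isOpen_ball).eqOn_of_preconnected_of_eventuallyEq
    (hG.analyticOnNhd Metric.isOpen_ball) (convex_ball 0 R).isPreconnected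
    (Metric.mem_ball_self (by positivity)) (by
      filter_upwards [Metric.ball_mem_nhds (0 : ℂ) one_pos] with z hz
      exact hnear z (by simpa using hz))
  have hb : b ∈ Metric.ball (0 : ℂ) R := by simp [hR]
  exact (hu.of_norm_bounded fun n => hle n b (by simp [hR])).hasSum.of_eq (fun _ => rfl)
    (heq hb).symm

end Main

/-! ### Back to the `₃φ₂` and conclusion -/

/-- Reverses the factors of `(q^(-n);q)_k` for `n = k + m`. The induction on `k` keeps `n` fixed, so
`m` must vary. -/
lemma qPoch_inv_pow_mul {q : ℂ} (hq0 : q ≠ 0) (k m : ℕ) :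
    qPoch (q ^ (k + m))⁻¹ q k * (q ^ (k + m)) ^ k * qPoch q q m =
      (-1) ^ k * q ^ (k * (k - 1) / 2) * qPoch q q (k + m) := by
  induction k generalizing m with
  | zero => simp [qPoch_zero]
  | succ k ih =>
    have h := ih (m + 1)
    rw [qPoch_succ q q m] at h
    have e : k + 1 + m = k + (m + 1) := by ring
    rw [e, qPoch_succ, Nat.triangle_succ, pow_add q (k * (k - 1) / 2), pow_succ (-1 : ℂ),
      pow_succ (q ^ (k + (m + 1)))]
    have hne : q ^ (k + (m + 1)) ≠ 0 := pow_ne_zero _ hq0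
    have e2 : (1 - (q ^ (k + (m + 1)))⁻¹ * q ^ k) * q ^ (k + (m + 1)) =
        -q ^ k * (1 - q * q ^ m) := by
      field_simp
      ring
    linear_combination (-q ^ k) * h + qPoch (q ^ (k + (m + 1)))⁻¹ q k *
      (q ^ (k + (m + 1))) ^ k * qPoch q q m * e2

lemma qPoch_inv_pow_eq_zero {q : ℂ} (hq0 : q ≠ 0) {n k : ℕ} (h : n < k) :
    qPoch (q ^ n)⁻¹ q k = 0 :=
  prod_eq_zero (mem_range.2 h) (by simp [hq0])

lemma basicHypTerm_three_two (a b x y q : ℂ) (n k : ℕ) :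
    basicHypTerm [(q ^ n)⁻¹, 1 / x, 1 / y] [a, b] q (a * b * x * y * q ^ n) k =
      qPoch (q ^ n)⁻¹ q k * qPoch (1 / x) q k * qPoch (1 / y) q k /
        (qPoch q q k * qPoch a q k * qPoch b q k) * (a * b * x * y * q ^ n) ^ k := by
  simp [basicHypTerm, qPochs, mul_assoc]

lemma basicHypTerm_three_two_eq_zero {q : ℂ} (hq0 : q ≠ 0) (a b x y : ℂ) {n k : ℕ} (h : n < k) :
    basicHypTerm [(q ^ n)⁻¹, 1 / x, 1 / y] [a, b] q (a * b * x * y * q ^ n) k = 0 := by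
  rw [basicHypTerm_three_two, qPoch_inv_pow_eq_zero hq0 h]
  simp

/-- Since `(a;q)_n = (a;q)_k (a q^k;q)_(n-k)`, the prefactor cancels the denominators in `a` and
`b`, which are nonzero by `ha` and `hb`. -/
lemma mul_basicHyp_three_two {q : ℂ} (hq0 : q ≠ 0) (hq : ‖q‖ < 1) {a b : ℂ}
    (ha : ∀ k : ℕ, a * q ^ k ≠ 1) (hb : ∀ k : ℕ, b * q ^ k ≠ 1) (x y : ℂ) (n : ℕ) :
    qPoch a q n * qPoch b q n / qPoch q q n *
      basicHyp [(q ^ n)⁻¹, 1 / x, 1 / y] [a, b] q (a * b * x * y * q ^ n) =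
    ∑ p ∈ antidiagonal n, expandedTerm q a x y b p := by
  rw [basicHyp, tsum_eq_sum (s := range (n + 1)) fun k hk =>
    basicHypTerm_three_two_eq_zero hq0 a b x y (by rw [mem_range] at hk; omega),
    ← Nat.succ_eq_add_one,
    ← Nat.sum_antidiagonal_eq_sum_range_succ (fun k _ =>
      basicHypTerm [(q ^ n)⁻¹, 1 / x, 1 / y] [a, b] q (a * b * x * y * q ^ n) k), mul_sum]
  refine sum_congr rfl fun p hp => ?_
  obtain ⟨k, m⟩ := p
  obtain rfl : k + m = n := mem_antidiagonal.1 hp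
  rw [basicHypTerm_three_two]
  simp only [expandedTerm]
  have h := qPoch_inv_pow_mul hq0 k m
  have h1 := qPoch_self_ne_zero hq k
  have h2 := qPoch_self_ne_zero hq m
  have h3 := qPoch_self_ne_zero hq (k + m)
  have h4 := qPoch_ne_zero ha k
  have h5 := qPoch_ne_zero hb k
  rw [qPoch_add a, qPoch_add b, mul_pow (a * b * x * y), neg_pow (a * b * x * y)]
  generalize qPoch (q ^ (k + m))⁻¹ q k = v at *
  generalize qPoch (b * q ^ k) q m = w at *
  generalize q ^ (k * (k - 1) / 2) = t at *
  generalize (q ^ (k + m)) ^ k = s at *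
  field_simp
  linear_combination (a * b * x * y) ^ k * qPoch (a * q ^ k) q m * w *
    qPoch (1 / x) q k * qPoch (1 / y) q k * h

theorem proposition12p9 (q : ℝ) (hq0 : 0 < q) (hq1 : q < 1) (a b x y : ℂ)
    (hx0 : x ≠ 0) (hy0 : y ≠ 0)
    (ha : ∀ k : ℕ, a * (q : ℂ) ^ k ≠ 1) (hb : ∀ k : ℕ, b * (q : ℂ) ^ k ≠ 1)
    (hmax : max ‖x‖ ‖a * b * x * y‖ < 1) :
    -- every inner series converges
    (∀ n : ℕ, Summable (basicHypTerm [((q : ℂ) ^ n)⁻¹, 1 / x, 1 / y] [a, b] (q : ℂ)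
      (a * b * x * y * (q : ℂ) ^ n))) ∧
    -- the outer series converges, with the stated sum
    HasSum (fun n : ℕ =>
        qPochs [a, b] (q : ℂ) n * x ^ n / qPochs [(q : ℂ), a * b * x * y] (q : ℂ) n *
          basicHyp [((q : ℂ) ^ n)⁻¹, 1 / x, 1 / y] [a, b] (q : ℂ) (a * b * x * y * (q : ℂ) ^ n))
      (qPochsInf [a * x, b * x] (q : ℂ) / qPochsInf [x, a * b * x * y] (q : ℂ)) ∧
    -- for `y = 1` the inner series is `1`, and what remains is the `q`-Gauss sum
    (y = 1 →
      (∀ n : ℕ, basicHyp [((q : ℂ) ^ n)⁻¹, 1 / x, 1 / y] [a, b] (q : ℂ)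
        (a * b * x * y * (q : ℂ) ^ n) = 1) ∧
      HasSum (basicHypTerm [a, b] [a * b * x] (q : ℂ) x)
        (qPochsInf [a * x, b * x] (q : ℂ) / qPochsInf [x, a * b * x] (q : ℂ))) := by
  have hQ0 : (q : ℂ) ≠ 0 := by exact_mod_cast hq0.ne'
  have hQ : ‖(q : ℂ)‖ < 1 := by simpa [abs_of_pos hq0] using hq1
  obtain ⟨hx, hw⟩ := max_lt_iff.1 hmax
  have hwne := mul_pow_ne_one hw hQ
  have hinf := qPochInf_ne_zero hQ hwne
  have hmain : HasSum (fun n : ℕ =>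
      qPochs [a, b] (q : ℂ) n * x ^ n / qPochs [(q : ℂ), a * b * x * y] (q : ℂ) n *
        basicHyp [((q : ℂ) ^ n)⁻¹, 1 / x, 1 / y] [a, b] (q : ℂ) (a * b * x * y * (q : ℂ) ^ n))
      (qPochsInf [a * x, b * x] (q : ℂ) / qPochsInf [x, a * b * x * y] (q : ℂ)) := by
    -- Dividing by `(abxy;q)_∞ = (abxy;q)_n (abxy q^n;q)_∞` restores the denominator `(abxy;q)_n`.
    refine ((hasSum_expanded hQ0 hQ a b hx0 hy0 hx).div_const
      (qPochInf (a * b * x * y) q)).of_eq (fun n => ?_) ?_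
    · have h1 := qPoch_ne_zero hwne n
      have h2 := qPoch_self_ne_zero hQ n
      have h3 := qPochInf_eq_mul hQ (a * b * x * y) n
      have h4 : qPochInf (a * b * x * y * (q : ℂ) ^ n) q ≠ 0 := right_ne_zero_of_mul (h3 ▸ hinf)
      rw [← mul_basicHyp_three_two hQ0 hQ ha hb x y n, h3]
      simp only [qPochs, List.map_cons, List.map_nil, List.prod_cons, List.prod_nil, mul_one]
      field_simp
    · simp only [qPochsInf, List.map_cons, List.map_nil, List.prod_cons, List.prod_nil, mul_one]
      rw [div_div]
  refine ⟨fun n => summable_of_ne_finset_zero (s := range (n + 1)) fun k hk =>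
    basicHypTerm_three_two_eq_zero hQ0 a b x y (by rw [mem_range] at hk; omega),
    hmain, ?_⟩
  rintro rfl
  have hone : ∀ n : ℕ, basicHyp [((q : ℂ) ^ n)⁻¹, 1 / x, 1 / 1] [a, b] (q : ℂ)
      (a * b * x * 1 * (q : ℂ) ^ n) = 1 := fun n => by
    rw [basicHyp, tsum_eq_single 0 fun k hk => ?_]
    · rw [basicHypTerm_three_two]
      simp [qPoch_zero]
    · obtain ⟨k, rfl⟩ := Nat.exists_eq_succ_of_ne_zero hk
      rw [basicHypTerm_three_two]
      simp [qPoch_one_succ]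
  refine ⟨hone, hmain.of_eq (fun n => ?_) (by rw [mul_one])⟩
  rw [hone, mul_one, mul_one]
  simp [basicHypTerm, mul_div_right_comm]
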